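/- **Setting.** An ultragraph $\mathcal{G}=(G^0,\mathcal{G}^1,r,s)$ consists of countable sets $G^0$ (vertices) and $\mathcal{G}^1$ (edges), a map $s:\mathcal{G}^1\to G^0$ and a map $r:\mathcal{G}^1\to P(G^0)\setminus\{\emptyset\}$. Let $\mathcal{G}^0\subset P(G^0)$ be the smallest family containing $\emptyset$, all singletons $\{v\}$ and all $r(e)$, and closed under finite unions and (nonempty) finite intersections. We write $p_v, D_v$ for $p_{\{v\}}, D_{\{v\}}$. A *cycle* is a tuple $\alpha=(\alpha_1,\dots,\alpha_n)$ of edges, $n\ge 1$, with $s(\alpha_{i+1})\in r(\alpha_i)$ for $1\le i<n$ and $s(\alpha_1)\in r(\alpha_n)$. Put $\alpha_{n+1}:=\alpha_1$. The cycle *has exits* if $s^{-1}(r(\alpha_i))\ne\{\alpha_{i+1}\}$ for some $1\le i\le n$, or $s^{-1}(v)=\emptyset$ for some $i$ and some $v\in r(\alpha_i)$. $\mathcal{G}$ satisfies *Condition (L)* if every cycle has exits. $C^*(\mathcal{G})$ is the universal C*-algebra generated by partial isometries $\{s_e\}_{e\in\mathcal{G}^1}$ with mutually orthogonal ranges and projections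 $\{p_A\}_{A\in\mathcal{G}^0}$ such that (1) $p_\emptyset=0$, $p_Ap_B=p_{A\cap B}$, $p_{A\cup B}=p_A+p_B-p_{A\cap B}$; (2) $s_e^*s_e=p_{r(e)}$; (3) $s_es_e^*\le p_{s(e)}$; (4) $p_v=\sum_{s(e)=v}s_es_e^*$ whenever $0<|s^{-1}(v)|<\infty$. A *$\mathcal{G}$-branching system* on a measure space $(X,\mu)$ consists of measurable sets $R_e, D_A\subset X$ ($e\in\mathcal{G}^1$, $A\in\mathcal{G}^0$) and measurable maps $f_e:D_{r(e)}\to R_e$, $f_e^{-1}:R_e\to D_{r(e)}$ such that, where equalities and inclusions of sets and of maps (except $D_\emptyset=\emptyset$) are modulo $\mu$-null sets: (1) $R_e\cap R_f=\emptyset$ for $e\ne f$; (2) $D_\emptyset=\emptyset$, $D_A\cap D_B=D_{A\cap B}$, $D_A\cup D_B=D_{A\cup B}$; (3) $R_e\subseteq D_{s(e)}$; (4) $D_v=\bigcup_{e\in s^{-1}(v)}R_e$ if $0<|s^{-1}(v)|<\infty$; (5) $f_e\circ f_e^{-1}=\mathrm{id}_{R_e}$ and $f_e^{-1}\circ f_e=\mathrm{id}_{D_{r(e)}}$,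 the pushforward $\mu\circ f_e$ of $\mu|_{R_e}$ under $f_e^{-1}$ is absolutely continuous with respect to $\mu|_{D_{r(e)}}$, and the pushforward $\mu\circ f_e^{-1}$ of $\mu|_{D_{r(e)}}$ under $f_e$ is absolutely continuous with respect to $\mu|_{R_e}$. Put $\Phi_{f_e^{-1}}=d(\mu\circ f_e^{-1})/d\mu$ on $R_e$. The *induced representation* is the *-homomorphism $\pi:C^*(\mathcal{G})\to B(L^2(X,\mu))$ with $\pi(s_e)\phi=\Phi_{f_e^{-1}}^{1/2}\cdot(\phi\circ f_e^{-1})$ (extended by $0$ outside $R_e$) and $\pi(p_A)\phi=\chi_{D_A}\phi$ for all $e\in\mathcal{G}^1$, $A\in\mathcal{G}^0$, $\phi\in L^2(X,\mu)$. **Theorem.** Let $\mathcal{G}$ be an ultragraph which does not satisfy Condition (L). Then there exists a $\mathcal{G}$-branching system on $(\mathbb{R},\mu)$, where $\mu$ is Lebesgue measure on the Borel sets, whose induced representation $\pi:C^*(\mathcal{G})\to B(L^2(\mathbb{R},\mu))$ exists and satisfies $\pi(p_A)\ne 0$ for all nonempty $A\in\mathcal{G}^0$, and $\pi$ is not faithful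 (not injective). -/

import Mathlib

open scoped ENNReal Topology
open MeasureTheory

universe u v w

/-- An ultragraph: countable sets `V` of vertices and `E` of edges, a source map
`E → V`, and a range map from `E` to the nonempty subsets of `V`. -/
structure Ultragraph (V : Type u) (E : Type v) where
  source : E → V
  range : E → Set V
  range_nonempty : ∀ e, (range e).Nonempty
  countable_vertices : Countable V
  countable_edges : Countable E

namespace Ultragraph

variable {V : Type u} {E : Type v}

/-- Membership in `𝒢⁰`, the smallest family of subsets of `V` that contains the singletons and the
ranges of edges and is closed under finite unions (including the empty one) and under
intersections of finitely many (at least one) members. -/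
inductive IsGenVertex (G : Ultragraph V E) : Set V → Prop
  | empty : IsGenVertex G ∅
  | single (v : V) : IsGenVertex G {v}
  | range (e : E) : IsGenVertex G (G.range e)
  | union {A B : Set V} : IsGenVertex G A → IsGenVertex G B → IsGenVertex G (A ∪ B)
  | inter {A B : Set V} : IsGenVertex G A → IsGenVertex G B → IsGenVertex G (A ∩ B)

/-- The family `𝒢⁰` of generalized vertices. -/
def GenVertex (G : Ultragraph V E) : Type u := {A : Set V // G.IsGenVertex A}

namespace GenVertex

variable {G : Ultragraph V E}

/-- The underlying set of vertices. -/
def carrier (A : G.GenVertex) : Set V := A.1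

instance : EmptyCollection G.GenVertex := ⟨⟨∅, .empty⟩⟩
instance : Union G.GenVertex := ⟨fun A B => ⟨A.1 ∪ B.1, .union A.2 B.2⟩⟩
instance : Inter G.GenVertex := ⟨fun A B => ⟨A.1 ∩ B.1, .inter A.2 B.2⟩⟩

end GenVertex

/-- The singleton `{v}` as an element of `𝒢⁰`. -/
def vert (G : Ultragraph V E) (v : V) : G.GenVertex := ⟨{v}, .single v⟩

/-- The range `r(e)` as an element of `𝒢⁰`. -/
def rangeVert (G : Ultragraph V E) (e : E) : G.GenVertex := ⟨G.range e, .range e⟩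

/-- The set `s⁻¹(v)` of edges emitted by `v`. -/
def emitted (G : Ultragraph V E) (v : V) : Set E := {e | G.source e = v}

/-! ### Cycles and Condition (L) -/

/-- A cycle `α = (α_0, …, α_n)`: a path of positive length whose source belongs to its range.
The index `i + 1` is cyclic in `Fin (n + 1)`, so `i = n` gives `s(α_0) ∈ r(α_n)`. -/
def IsCycle (G : Ultragraph V E) {n : ℕ} (α : Fin (n + 1) → E) : Prop :=
  ∀ i, G.source (α (i + 1)) ∈ G.range (α i)

/-- The cycle `α` has exits: some `r(α_i)` emits a set of edges other than `{α_{i+1}}`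
(with cyclic indices), or some `r(α_i)` contains a sink. -/
def HasExits (G : Ultragraph V E) {n : ℕ} (α : Fin (n + 1) → E) : Prop :=
  (∃ i, G.source ⁻¹' G.range (α i) ≠ {α (i + 1)}) ∨
    ∃ i, ∃ x ∈ G.range (α i), G.emitted x = ∅

/-- Condition (L): every cycle has exits. -/
def ConditionL (G : Ultragraph V E) : Prop :=
  ∀ (n : ℕ) (α : Fin (n + 1) → E), G.IsCycle α → G.HasExits α

/-! ### Cuntz–Krieger families and the ultragraph C*-algebra -/

/-- A Cuntz–Krieger `𝒢`-family in a (not necessarily unital) C*-algebra `B`. -/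
structure CKFamily (G : Ultragraph V E) (B : Type w) [NonUnitalCStarAlgebra B] where
  /-- the partial isometries -/
  s : E → B
  /-- the projections -/
  p : G.GenVertex → B
  isPartialIsometry : ∀ e, s e * star (s e) * s e = s e
  orthogonal_ranges : ∀ e f, e ≠ f → (s e * star (s e)) * (s f * star (s f)) = 0
  isProjection : ∀ A, IsStarProjection (p A)
  p_empty : p ∅ = 0
  p_inter : ∀ A B, p A * p B = p (A ∩ B)
  p_union : ∀ A B, p (A ∪ B) = p A + p B - p (A ∩ B)
  star_s_mul_s : ∀ e, star (s e) * s e = p (G.rangeVert e)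
  /-- `s_e s_e^* ≤ p_{s(e)}` for projections: `q ≤ p` means `p q = q`. -/
  range_le : ∀ e, p (G.vert (G.source e)) * (s e * star (s e)) = s e * star (s e)
  sum_eq : ∀ (x : V) (hx : (G.emitted x).Finite), (G.emitted x).Nonempty →
    p (G.vert x) = ∑ e ∈ hx.toFinset, s e * star (s e)

/-- A Cuntz–Krieger family together with the C*-algebra in which it lives. A family generates a
separable C*-algebra (there are countably many generators), which has an isomorphic copy in `Type`;
so families in C*-algebras in `Type` suffice for the universal property. -/
structure CKRep (G : Ultragraph V E) where
  B : Type
  [inst : NonUnitalCStarAlgebra B]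
  fam : G.CKFamily B

attribute [instance] CKRep.inst

theorem norm_le_one_of_isStarProjection {B : Type w} [NonUnitalCStarAlgebra B] {q : B}
    (h : IsStarProjection q) : ‖q‖ ≤ 1 := by
  have h1 : ‖q‖ = ‖q‖ * ‖q‖ := by
    have := CStarRing.norm_star_mul_self (x := q)
    rwa [h.isSelfAdjoint.star_eq, h.isIdempotentElem.eq] at this
  by_contra! h2
  nlinarith

theorem CKFamily.norm_p_le {G : Ultragraph V E} {B : Type w} [NonUnitalCStarAlgebra B]
    (F : G.CKFamily B) (A : G.GenVertex) : ‖F.p A‖ ≤ 1 :=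
  norm_le_one_of_isStarProjection (F.isProjection A)

theorem CKFamily.norm_s_le {G : Ultragraph V E} {B : Type w} [NonUnitalCStarAlgebra B]
    (F : G.CKFamily B) (e : E) : ‖F.s e‖ ≤ 1 := by
  have h1 := CStarRing.norm_star_mul_self (x := F.s e)
  rw [F.star_s_mul_s] at h1
  have h2 := F.norm_p_le (G.rangeVert e)
  by_contra! h3
  nlinarith

section Universal

variable (G : Ultragraph V E)

/-- The C*-algebra of bounded families indexed by all Cuntz–Krieger families. -/
abbrev BigProduct : Type (max u v 1) := lp (fun F : G.CKRep => F.B) ∞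

/-- The edge generator, as the family of the edge generators of all Cuntz–Krieger families. -/
def bigS (e : E) : G.BigProduct :=
  ⟨fun F => F.fam.s e, memℓp_infty ⟨1, by rintro _ ⟨F, rfl⟩; exact F.fam.norm_s_le e⟩⟩

/-- The vertex generator, as the family of the vertex generators of all Cuntz–Krieger families. -/
def bigP (A : G.GenVertex) : G.BigProduct :=
  ⟨fun F => F.fam.p A, memℓp_infty ⟨1, by rintro _ ⟨F, rfl⟩; exact F.fam.norm_p_le A⟩⟩

/-- The C*-subalgebra generated by the universal generators. -/
noncomputable def algSubalgebra : NonUnitalStarSubalgebra ℂ G.BigProduct :=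
  (NonUnitalStarAlgebra.adjoin ℂ (Set.range G.bigS ∪ Set.range G.bigP)).topologicalClosure

/-- The ultragraph C*-algebra `C*(𝒢)`: the universal C*-algebra generated by a Cuntz–Krieger
`𝒢`-family. It is realized as the C*-algebra generated, in the product of all Cuntz–Krieger
families, by the tuples of their generators; the universal property is `algLift_existsUnique`. -/
def Alg : Type (max u v 1) := G.algSubalgebra

noncomputable instance : NonUnitalCStarAlgebra G.Alg :=
  NonUnitalStarSubalgebra.nonUnitalCStarAlgebra G.algSubalgebra
    (h_closed := NonUnitalStarSubalgebra.isClosed_topologicalClosure _)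

/-- The generating partial isometry `s_e ∈ C*(𝒢)`. -/
noncomputable def algS (e : E) : G.Alg :=
  ⟨G.bigS e, NonUnitalStarSubalgebra.le_topologicalClosure _
    (NonUnitalStarAlgebra.subset_adjoin ℂ _ (Or.inl ⟨e, rfl⟩))⟩

/-- The generating projection `p_A ∈ C*(𝒢)`. -/
noncomputable def algP (A : G.GenVertex) : G.Alg :=
  ⟨G.bigP A, NonUnitalStarSubalgebra.le_topologicalClosure _
    (NonUnitalStarAlgebra.subset_adjoin ℂ _ (Or.inr ⟨A, rfl⟩))⟩

/-- Evaluation of `C*(𝒢)` at a Cuntz–Krieger family. -/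
noncomputable def algEval (F : G.CKRep) : G.Alg →⋆ₙₐ[ℂ] F.B where
  toFun x := x.1 F
  map_smul' _ _ := rfl
  map_zero' := rfl
  map_add' _ _ := rfl
  map_mul' _ _ := rfl
  map_star' _ := rfl

theorem alg_ext {x y : G.Alg} (h : ∀ F, G.algEval F x = G.algEval F y) : x = y :=
  Subtype.ext (Subtype.ext (funext h))

/-- The universal Cuntz–Krieger family in `C*(𝒢)`. -/
noncomputable def algFamily : G.CKFamily G.Alg where
  s := G.algS
  p := G.algP
  isPartialIsometry e := G.alg_ext fun F => F.fam.isPartialIsometry e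
  orthogonal_ranges e f h := G.alg_ext fun F => F.fam.orthogonal_ranges e f h
  isProjection A := ⟨G.alg_ext fun F => (F.fam.isProjection A).1,
    G.alg_ext fun F => (F.fam.isProjection A).2⟩
  p_empty := G.alg_ext fun F => F.fam.p_empty
  p_inter A B := G.alg_ext fun F => F.fam.p_inter A B
  p_union A B := G.alg_ext fun F => F.fam.p_union A B
  star_s_mul_s e := G.alg_ext fun F => F.fam.star_s_mul_s e
  range_le e := G.alg_ext fun F => F.fam.range_le e
  sum_eq x hx hne := G.alg_ext fun F => by
    rw [map_sum]
    exact F.fam.sum_eq x hx hne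

/-- Two *-homomorphisms on `C*(𝒢)` that agree on the generators are equal. -/
theorem algHom_ext {B : Type w} [NonUnitalCStarAlgebra B] {φ ψ : G.Alg →⋆ₙₐ[ℂ] B}
    (hs : ∀ e, φ (G.algS e) = ψ (G.algS e)) (hp : ∀ A, φ (G.algP A) = ψ (G.algP A)) : φ = ψ := by
  let T := NonUnitalStarAlgebra.adjoin ℂ (Set.range G.bigS ∪ Set.range G.bigP)
  let j : T →⋆ₙₐ[ℂ] G.Alg :=
    { toFun := fun y => ⟨y.1, NonUnitalStarSubalgebra.le_topologicalClosure T y.2⟩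
      map_smul' := fun _ _ => rfl
      map_zero' := rfl
      map_add' := fun _ _ => rfl
      map_mul' := fun _ _ => rfl
      map_star' := fun _ => rfl }
  have hT : ∀ y (hy : y ∈ T), φ (j ⟨y, hy⟩) = ψ (j ⟨y, hy⟩) := by
    intro y hy
    induction hy using NonUnitalStarAlgebra.adjoin_induction with
    | mem x hx =>
      rcases hx with ⟨e, rfl⟩ | ⟨A, rfl⟩
      · exact hs e
      · exact hp A
    | add x y hx hy h1 h2 =>
      have : j ⟨x + y, add_mem hx hy⟩ = j ⟨x, hx⟩ + j ⟨y, hy⟩ := rfl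
      rw [this, map_add, map_add, h1, h2]
    | zero => exact (map_zero φ).trans (map_zero ψ).symm
    | mul x y hx hy h1 h2 =>
      have : j ⟨x * y, mul_mem hx hy⟩ = j ⟨x, hx⟩ * j ⟨y, hy⟩ := rfl
      rw [this, map_mul, map_mul, h1, h2]
    | smul r x hx h1 =>
      have : j ⟨r • x, SMulMemClass.smul_mem r hx⟩ = r • j ⟨x, hx⟩ := rfl
      rw [this, map_smul, map_smul, h1]
    | star x hx h1 =>
      have : j ⟨star x, star_mem hx⟩ = star (j ⟨x, hx⟩) := rfl
      rw [this, map_star, map_star, h1]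
  have hφ : Continuous φ := AddMonoidHomClass.continuous_of_bound φ 1 fun a => by
    simpa using NonUnitalStarAlgHom.norm_apply_le φ a
  have hψ : Continuous ψ := AddMonoidHomClass.continuous_of_bound ψ 1 fun a => by
    simpa using NonUnitalStarAlgHom.norm_apply_le ψ a
  have hcl : IsClosed {x | φ x = ψ x} := isClosed_eq hφ hψ
  refine DFunLike.ext _ _ fun x => hcl.closure_subset ?_
  let i : G.Alg → G.BigProduct := fun x => x.1
  have hi : Isometry i := fun _ _ => rfl
  rw [hi.isUniformInducing.isInducing.closure_eq_preimage_closure_image]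
  refine closure_mono ?_ x.2
  exact fun y hy => ⟨j ⟨y, hy⟩, hT y hy, rfl⟩

/-- The universal property of `C*(𝒢)`. -/
theorem algLift_existsUnique {B : Type} [NonUnitalCStarAlgebra B] (F : G.CKFamily B) :
    ∃! φ : G.Alg →⋆ₙₐ[ℂ] B, (∀ e, φ (G.algS e) = F.s e) ∧ ∀ A, φ (G.algP A) = F.p A :=
  ⟨G.algEval ⟨B, F⟩, ⟨fun _ => rfl, fun _ => rfl⟩, fun _ h =>
    G.algHom_ext (fun e => h.1 e) (fun A => h.2 A)⟩

end Universal

/-! ### Branching systems -/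

/-- A `𝒢`-branching system on a measure space `(X, μ)`. The maps `f_e : D_{r(e)} → R_e` and
`f_e⁻¹ : R_e → D_{r(e)}` are given by measurable maps `f e` and `g e` on `X`, whose values
outside `D_{r(e)}` and `R_e` respectively play no role. -/
structure BranchingSystem (G : Ultragraph V E) {X : Type w} [MeasurableSpace X]
    (μ : Measure X) where
  R : E → Set X
  D : G.GenVertex → Set X
  f : E → X → X
  g : E → X → X
  measurableSet_R : ∀ e, MeasurableSet (R e)
  measurableSet_D : ∀ A, MeasurableSet (D A)
  R_disjoint : ∀ e e', e ≠ e' → (R e ∩ R e' : Set X) =ᵐ[μ] (∅ : Set X)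
  D_empty : D ∅ = ∅
  D_inter : ∀ A B, (D A ∩ D B : Set X) =ᵐ[μ] D (A ∩ B)
  D_union : ∀ A B, (D A ∪ D B : Set X) =ᵐ[μ] D (A ∪ B)
  R_subset : ∀ e, R e ≤ᵐ[μ] D (G.vert (G.source e))
  D_vert : ∀ x, (G.emitted x).Finite → (G.emitted x).Nonempty →
    D (G.vert x) =ᵐ[μ] (⋃ e ∈ G.emitted x, R e : Set X)
  measurable_f : ∀ e, Measurable (f e)
  measurable_g : ∀ e, Measurable (g e)
  mapsTo_f : ∀ e, Set.MapsTo (f e) (D (G.rangeVert e)) (R e)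
  mapsTo_g : ∀ e, Set.MapsTo (g e) (R e) (D (G.rangeVert e))
  f_g : ∀ e, ∀ᵐ x ∂μ.restrict (R e), f e (g e x) = x
  g_f : ∀ e, ∀ᵐ x ∂μ.restrict (D (G.rangeVert e)), g e (f e x) = x
  /-- `μ ∘ f_e`, the pushforward under `f_e⁻¹` of `μ` on `R_e`, is absolutely continuous. -/
  map_g_ac : ∀ e, (μ.restrict (R e)).map (g e) ≪ μ.restrict (D (G.rangeVert e))
  /-- `μ ∘ f_e⁻¹`, the pushforward under `f_e` of `μ` on `D_{r(e)}`, is absolutely continuous. -/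
  map_f_ac : ∀ e, (μ.restrict (D (G.rangeVert e))).map (f e) ≪ μ.restrict (R e)

namespace BranchingSystem

variable {G : Ultragraph V E} {X : Type w} [MeasurableSpace X] {μ : Measure X}

/-- The Radon–Nikodym derivative `Φ_{f_e⁻¹} = d(μ ∘ f_e⁻¹)/dμ` on `R_e`. -/
noncomputable def derivInv (S : G.BranchingSystem μ) (e : E) : X → ℝ≥0∞ :=
  ((μ.restrict (S.D (G.rangeVert e))).map (S.f e)).rnDeriv (μ.restrict (S.R e))

/-- `π` is the representation of `C*(𝒢)` on `L²(X, μ)` induced by the branching system, i.e. the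
one with `π(s_e) φ = Φ_{f_e⁻¹}^{1/2} · (φ ∘ f_e⁻¹)` (extended by zero outside `R_e`) and
`π(p_A) φ = χ_{D_A} φ`. -/
def IsInducedRep (S : G.BranchingSystem μ)
    (π : G.Alg →⋆ₙₐ[ℂ] (Lp ℂ 2 μ →L[ℂ] Lp ℂ 2 μ)) : Prop :=
  (∀ (e : E) (φ : Lp ℂ 2 μ), (π (G.algS e) φ : X → ℂ) =ᵐ[μ]
    (S.R e).indicator fun x => (Real.sqrt (S.derivInv e x).toReal : ℂ) * φ (S.g e x)) ∧
  ∀ (A : G.GenVertex) (φ : Lp ℂ 2 μ), (π (G.algP A) φ : X → ℂ) =ᵐ[μ] (S.D A).indicator φ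

end BranchingSystem

end Ultragraph

/-! If Condition (L) fails, some cycle `α` has no exit: each `r(α_i)` is the single vertex
`s(α_{i+1})`, which emits only `α_{i+1}`. In any branching system `f_{α_i}` then carries
`R_{α_{i+1}}` onto `R_{α_i}` modulo null sets. The maps can be chosen so that their composite around
the cycle is the identity, and then `π` sends both `s_α` (the product of the `s_{α_i}`) and
`p_{s(α_1)}` to the same nonzero projection.

These two elements differ in `C*(𝒢)`: multiplying every `s_e` by a scalar `ζ` of modulus 1 gives
another Cuntz–Krieger family, in which `s_α` is `ζ ^ |α|` times the image of `p_{s(α_1)}`, and `ζ`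
can be chosen with `ζ ^ |α| = -1`.

The sets are unions of unit intervals of the line, and the maps permute these intervals by
translation. Relations among operators thus reduce to combinatorics of labels (`unit_mul_unit`,
`unit_mul_proj`); the cycle is handled by `exists_edgePerm`, `exists_periodic_of_not_conditionL` and
`algEval_algWord_of_periodic`. -/

namespace MeasureTheory.Lp

/-! ### Multiplication by indicator functions on `L²`. -/

variable {X : Type*} [MeasurableSpace X] {μ : Measure X}

/-- Multiplication by the indicator function of a measurable set, as an operator on `L²`. -/
noncomputable def indicatorCLM (μ : Measure X) (S : Set X) (hS : MeasurableSet S) :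
    Lp ℂ 2 μ →L[ℂ] Lp ℂ 2 μ :=
  LinearMap.mkContinuous
    { toFun := fun φ => ((Lp.memLp φ).indicator hS).toLp (S.indicator φ)
      map_add' := fun φ ψ => by
        refine Lp.ext ?_
        filter_upwards [((Lp.memLp (φ + ψ)).indicator hS).coeFn_toLp, Lp.coeFn_add φ ψ,
          Lp.coeFn_add (((Lp.memLp φ).indicator hS).toLp _) (((Lp.memLp ψ).indicator hS).toLp _),
          ((Lp.memLp φ).indicator hS).coeFn_toLp, ((Lp.memLp ψ).indicator hS).coeFn_toLp]
          with x h1 h2 h3 h4 h5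
        by_cases hx : x ∈ S <;> simp_all
      map_smul' := fun a φ => by
        refine Lp.ext ?_
        filter_upwards [((Lp.memLp (a • φ)).indicator hS).coeFn_toLp, Lp.coeFn_smul a φ,
          Lp.coeFn_smul a (((Lp.memLp φ).indicator hS).toLp _),
          ((Lp.memLp φ).indicator hS).coeFn_toLp] with x h1 h2 h3 h4
        by_cases hx : x ∈ S <;> simp_all }
    1 fun φ => by
      rw [one_mul]
      refine Lp.norm_le_norm_of_ae_le ?_
      filter_upwards [((Lp.memLp φ).indicator hS).coeFn_toLp] with x h
      exact h ▸ norm_indicator_le_norm_self _ _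

theorem coeFn_indicatorCLM {S : Set X} (hS : MeasurableSet S) (φ : Lp ℂ 2 μ) :
    indicatorCLM μ S hS φ =ᵐ[μ] S.indicator φ :=
  ((Lp.memLp φ).indicator hS).coeFn_toLp

theorem indicatorCLM_mul {S T : Set X} (hS : MeasurableSet S) (hT : MeasurableSet T) :
    indicatorCLM μ S hS * indicatorCLM μ T hT = indicatorCLM μ (S ∩ T) (hS.inter hT) := by
  refine ContinuousLinearMap.ext fun φ => Lp.ext ?_
  filter_upwards [coeFn_indicatorCLM hS (indicatorCLM μ T hT φ), coeFn_indicatorCLM hT φ,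
    coeFn_indicatorCLM (hS.inter hT) φ] with x h1 h2 h3
  rw [mul_apply_eq_comp, h1, h3]
  by_cases hx : x ∈ S <;> by_cases hx' : x ∈ T <;> simp [hx, hx', h2]

theorem indicatorCLM_empty : indicatorCLM μ ∅ .empty = 0 := by
  refine ContinuousLinearMap.ext fun φ => Lp.ext ?_
  filter_upwards [coeFn_indicatorCLM .empty φ, Lp.coeFn_zero ℂ 2 μ] with x h1 h2
  rw [h1, Set.indicator_empty, zero_apply, h2, Pi.zero_apply]

theorem indicatorCLM_union {S T : Set X} (hS : MeasurableSet S) (hT : MeasurableSet T) :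
    indicatorCLM μ (S ∪ T) (hS.union hT) =
      indicatorCLM μ S hS + indicatorCLM μ T hT - indicatorCLM μ (S ∩ T) (hS.inter hT) := by
  refine ContinuousLinearMap.ext fun φ => Lp.ext ?_
  filter_upwards [coeFn_indicatorCLM hS φ, coeFn_indicatorCLM hT φ,
    coeFn_indicatorCLM (hS.inter hT) φ, coeFn_indicatorCLM (hS.union hT) φ,
    Lp.coeFn_sub (indicatorCLM μ S hS φ + indicatorCLM μ T hT φ)
      (indicatorCLM μ (S ∩ T) (hS.inter hT) φ),
    Lp.coeFn_add (indicatorCLM μ S hS φ) (indicatorCLM μ T hT φ)] with x h1 h2 h3 h4 h5 h6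
  rw [sub_apply, add_apply, h5, h4, Pi.sub_apply, h6,
    Pi.add_apply, h1, h2, h3]
  by_cases hx : x ∈ S <;> by_cases hx' : x ∈ T <;> simp [hx, hx']

theorem isSelfAdjoint_indicatorCLM {S : Set X} (hS : MeasurableSet S) :
    IsSelfAdjoint (indicatorCLM μ S hS) := by
  rw [ContinuousLinearMap.isSelfAdjoint_iff_isSymmetric]
  intro φ ψ
  rw [L2.inner_def, L2.inner_def]
  refine integral_congr_ae ?_
  filter_upwards [coeFn_indicatorCLM hS φ, coeFn_indicatorCLM hS ψ] with x h1 h2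
  simp only [ContinuousLinearMap.coe_coe, h1, h2]
  by_cases hx : x ∈ S <;> simp [hx]

/-- The set `S` may have infinite measure, so the test vector is the indicator of a subset `T` of
finite positive measure. -/
theorem indicatorCLM_ne_zero {S T : Set X} (hS : MeasurableSet S) (hT : MeasurableSet T)
    (hTS : T ⊆ S) (h0 : μ T ≠ 0) (hfin : μ T ≠ ∞) : indicatorCLM μ S hS ≠ 0 := by
  intro h
  have h1 := coeFn_indicatorCLM hS (indicatorConstLp 2 hT hfin (1 : ℂ))
  rw [h, zero_apply] at h1
  refine h0 (measure_mono_null ?_ (ae_iff.1 ((h1.symm.trans (Lp.coeFn_zero ℂ 2 μ)).and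
    (indicatorConstLp_coeFn (p := 2) (hs := hT) (hμs := hfin) (c := (1 : ℂ))))))
  rintro x hx ⟨h2, h3⟩
  simp [hTS hx, h3, hx] at h2

end MeasureTheory.Lp

/-! ### Permutations of the unit intervals of the line. -/

namespace UnitCells

variable {I : Type*} (c : I ≃ ℤ)

/-- The label of the unit interval `[n, n + 1)` that contains `x`. -/
noncomputable def label (x : ℝ) : I := c.symm ⌊x⌋

/-- The piecewise translation that permutes the unit intervals by `σ`. -/
noncomputable def permute (σ : Equiv.Perm I) (x : ℝ) : ℝ := c (σ (label c x)) + Int.fract x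

theorem label_permute (σ : Equiv.Perm I) (x : ℝ) : label c (permute c σ x) = σ (label c x) := by
  simp [label, permute]

theorem permute_permute (σ τ : Equiv.Perm I) (x : ℝ) :
    permute c σ (permute c τ x) = permute c (σ * τ) x := by
  rw [permute, label_permute, permute, Int.fract_intCast_add, Int.fract_fract]
  rfl

theorem permute_eq_self {σ : Equiv.Perm I} {x : ℝ} (h : σ (label c x) = label c x) :
    permute c σ x = x := by
  rw [permute, h, label, c.apply_symm_apply, Int.floor_add_fract]

theorem permute_inv_permute (σ : Equiv.Perm I) (x : ℝ) : permute c σ⁻¹ (permute c σ x) = x := by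
  rw [permute_permute, permute_eq_self]; simp

theorem permute_permute_inv (σ : Equiv.Perm I) (x : ℝ) : permute c σ (permute c σ⁻¹ x) = x := by
  rw [permute_permute, permute_eq_self]; simp

theorem measurable_permute (σ : Equiv.Perm I) : Measurable (permute c σ) := by
  have h : Measurable fun n : ℤ => ((c (σ (c.symm n)) : ℤ) : ℝ) := measurable_from_top
  exact (h.comp Int.measurable_floor).add measurable_fract

theorem measurableSet_label (S : Set I) : MeasurableSet (label c ⁻¹' S) :=
  Int.measurable_floor (MeasurableSet.of_discrete (s := c.symm ⁻¹' S))

theorem volume_eq_tsum (B : Set ℝ) (hB : MeasurableSet B) :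
    volume B = ∑' i, volume (B ∩ label c ⁻¹' {i}) := by
  have : Countable I := c.countable_iff.2 inferInstance
  rw [← measure_iUnion]
  · congr 1
    ext x
    simp
  · intro i j hij
    refine Set.disjoint_left.2 fun x hx hx' => hij ?_
    exact hx.2.symm.trans hx'.2
  · exact fun i => hB.inter (measurableSet_label c _)

/-- By countable additivity it suffices to treat one unit interval at a time, and there the map is a
translation. -/
theorem measurePreserving_permute (σ : Equiv.Perm I) :
    MeasurePreserving (permute c σ) volume volume := by
  refine ⟨measurable_permute c σ, Measure.ext fun B hB => ?_⟩
  rw [Measure.map_apply (measurable_permute c σ) hB, volume_eq_tsum c _ hB,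
    volume_eq_tsum c _ (measurable_permute c σ hB),
    ← σ.tsum_eq fun i => volume (B ∩ label c ⁻¹' {i})]
  refine tsum_congr fun i => ?_
  rw [← measure_preimage_add_right volume ((c (σ i) : ℝ) - c i) (B ∩ label c ⁻¹' {σ i})]
  congr 1
  ext x
  have h1 : label c (x + ((c (σ i) : ℝ) - c i)) = σ i ↔ label c x = i := by
    have : x + ((c (σ i) : ℝ) - c i) = x + ((c (σ i) - c i : ℤ) : ℝ) := by push_cast; ring
    rw [this, label, Int.floor_add_intCast, c.symm_apply_eq, label, c.symm_apply_eq]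
    omega
  simp only [Set.mem_inter_iff, Set.mem_preimage, Set.mem_singleton_iff, h1]
  refine and_congr_left fun h => ?_
  have h2 : (⌊x⌋ : ℝ) = c i := by rw [← h]; simp [label]
  rw [permute, h, Int.fract, h2]
  ring_nf

/-- This yields both absolute continuity conditions, and Radon–Nikodym derivative 1. -/
theorem map_permute_restrict (σ : Equiv.Perm I) (S : Set I) :
    Measure.map (permute c σ) (volume.restrict (label c ⁻¹' (σ ⁻¹' S))) =
      volume.restrict (label c ⁻¹' S) := by
  rw [← ((measurePreserving_permute c σ).restrict_preimage (measurableSet_label c S)).map_eq]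
  congr 2
  ext x
  simp only [Set.mem_preimage, label_permute]

/-! ### The operators of interval projections and interval permutations. -/

/-- The orthogonal projection onto the functions supported on the unit intervals labelled
by `S`. -/
noncomputable def proj (S : Set I) :
    Lp ℂ 2 (volume : Measure ℝ) →L[ℂ] Lp ℂ 2 (volume : Measure ℝ) :=
  Lp.indicatorCLM volume (label c ⁻¹' S) (measurableSet_label c S)

/-- The unitary operator of composition with `permute c σ`. -/
noncomputable def unit (σ : Equiv.Perm I) :
    Lp ℂ 2 (volume : Measure ℝ) →L[ℂ] Lp ℂ 2 (volume : Measure ℝ) :=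
  (Lp.compMeasurePreservingₗᵢ ℂ _ (measurePreserving_permute c σ)).toContinuousLinearMap

theorem coeFn_proj (S : Set I) (φ : Lp ℂ 2 (volume : Measure ℝ)) :
    proj c S φ =ᵐ[volume] (label c ⁻¹' S).indicator φ :=
  Lp.coeFn_indicatorCLM _ φ

theorem coeFn_unit (σ : Equiv.Perm I) (φ : Lp ℂ 2 (volume : Measure ℝ)) :
    unit c σ φ =ᵐ[volume] φ ∘ permute c σ :=
  Lp.coeFn_compMeasurePreserving φ (measurePreserving_permute c σ)

theorem coeFn_proj_mul_unit (S : Set I) (σ : Equiv.Perm I) (φ : Lp ℂ 2 (volume : Measure ℝ)) :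
    (proj c S * unit c σ) φ =ᵐ[volume] (label c ⁻¹' S).indicator (φ ∘ permute c σ) := by
  filter_upwards [coeFn_proj c S (unit c σ φ), coeFn_unit c σ φ] with x h1 h2
  rw [mul_apply_eq_comp, h1]
  by_cases hx : x ∈ label c ⁻¹' S <;> simp [hx, h2]

theorem proj_mul_proj (S T : Set I) : proj c S * proj c T = proj c (S ∩ T) :=
  Lp.indicatorCLM_mul _ _

theorem proj_empty : proj c ∅ = 0 := Lp.indicatorCLM_empty

theorem proj_union (S T : Set I) : proj c (S ∪ T) = proj c S + proj c T - proj c (S ∩ T) :=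
  Lp.indicatorCLM_union _ _

theorem star_proj (S : Set I) : star (proj c S) = proj c S :=
  (Lp.isSelfAdjoint_indicatorCLM _).star_eq

theorem isStarProjection_proj (S : Set I) : IsStarProjection (proj c S) :=
  ⟨by rw [IsIdempotentElem, proj_mul_proj, Set.inter_self], star_proj c S⟩

theorem proj_biUnion {ι : Type*} (t : Finset ι) (S : ι → Set I)
    (h : ∀ i j, i ≠ j → Disjoint (S i) (S j)) :
    proj c (⋃ i ∈ t, S i) = ∑ i ∈ t, proj c (S i) := by
  classical
  induction t using Finset.induction_on with
  | empty => simp [proj_empty]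
  | insert a t ha ih =>
    have hd : S a ∩ ⋃ i ∈ t, S i = ∅ := by
      rw [← Set.disjoint_iff_inter_eq_empty]
      simp only [Set.disjoint_iUnion_right]
      exact fun i hi => h a i fun e => ha (e ▸ hi)
    rw [Finset.set_biUnion_insert, proj_union, hd, proj_empty, sub_zero, ih,
      Finset.sum_insert ha]

theorem proj_ne_zero {S : Set I} (hS : S.Nonempty) : proj c S ≠ 0 := by
  obtain ⟨i, hi⟩ := hS
  refine Lp.indicatorCLM_ne_zero _ (measurableSet_Ico (a := (c i : ℝ)) (b := c i + 1)) ?_ ?_ ?_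
  · intro x hx
    have : ⌊x⌋ = c i := Int.floor_eq_iff.2 hx
    simpa [label, this] using hi
  · simp
  · simp

theorem unit_mul_unit (σ τ : Equiv.Perm I) : unit c σ * unit c τ = unit c (τ * σ) := by
  refine ContinuousLinearMap.ext fun φ => Lp.ext ?_
  filter_upwards [coeFn_unit c σ (unit c τ φ), coeFn_unit c (τ * σ) φ,
    (measurePreserving_permute c σ).quasiMeasurePreserving.ae (coeFn_unit c τ φ)] with x h1 h2 h3
  rw [mul_apply_eq_comp, h1, h2, Function.comp_apply, h3]
  simp [permute_permute]

/-- Applied to the cycle: once the composite permutation fixes the labels, the word collapses to a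
projection. -/
theorem proj_mul_unit_of_fixed {S : Set I} {σ : Equiv.Perm I} (h : ∀ i ∈ S, σ i = i) :
    proj c S * unit c σ = proj c S := by
  refine ContinuousLinearMap.ext fun φ => Lp.ext ?_
  filter_upwards [coeFn_proj_mul_unit c S σ φ, coeFn_proj c S φ] with x h1 h2
  rw [h1, h2]
  by_cases hx : x ∈ label c ⁻¹' S
  · simp [hx, permute_eq_self c (h _ hx)]
  · simp [hx]

theorem unit_one : unit c 1 = 1 := by
  refine ContinuousLinearMap.ext fun φ => Lp.ext ?_
  filter_upwards [coeFn_unit c 1 φ] with x h1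
  rw [h1, Function.comp_apply, permute_eq_self c (by simp)]
  rfl

theorem star_unit (σ : Equiv.Perm I) : star (unit c σ) = unit c σ⁻¹ := by
  have h1 : star (unit c σ) * unit c σ = 1 := LinearIsometry.adjoint_comp_self _
  have h2 : unit c σ * unit c σ⁻¹ = 1 := by rw [unit_mul_unit, inv_mul_cancel, unit_one]
  exact left_inv_eq_right_inv h1 h2

/-- The covariance relation, used to collect all projections on the left of a product. -/
theorem unit_mul_proj (σ : Equiv.Perm I) (S : Set I) :
    unit c σ * proj c S = proj c (σ ⁻¹' S) * unit c σ := by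
  refine ContinuousLinearMap.ext fun φ => Lp.ext ?_
  filter_upwards [coeFn_unit c σ (proj c S φ), coeFn_proj_mul_unit c (σ ⁻¹' S) σ φ,
    (measurePreserving_permute c σ).quasiMeasurePreserving.ae (coeFn_proj c S φ)] with x h1 h2 h3
  rw [mul_apply_eq_comp, h1, h2, Function.comp_apply, h3]
  classical
  simp only [Set.indicator_apply, Set.mem_preimage, label_permute, Function.comp_apply]

end UnitCells

/-! ### Labels attached to edges and vertices. -/

namespace Ultragraph

variable {V : Type u} {E : Type v} (G : Ultragraph V E)

/-- Labels of unit intervals: countably many for every vertex, for every edge, and to spare. -/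
abbrev CellLabel (V : Type u) (E : Type v) : Type (max u v) := Option (V ⊕ E) × ℕ

/-- The labels that belong to the edge `e`. -/
def edgeCells (V : Type u) {E : Type v} (e : E) : Set (CellLabel V E) := {i | i.1 = some (.inr e)}

/-- The labels that belong to the vertex `x`: those of the edges that it emits, and those of `x`
itself if `x` is a sink or an infinite emitter. -/
def vertCells (x : V) : Set (CellLabel V E) :=
  {i | (∃ e, G.source e = x ∧ i.1 = some (.inr e)) ∨
    (i.1 = some (.inl x) ∧ ¬ ((G.emitted x).Finite ∧ (G.emitted x).Nonempty))}

/-- The labels that belong to the vertices in `A`. -/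
def genCells (A : Set V) : Set (CellLabel V E) := {i | ∃ x ∈ A, i ∈ G.vertCells x}

variable {G}

theorem mk_mem_edgeCells (e : E) (m : ℕ) : (some (.inr e), m) ∈ edgeCells V e := rfl

theorem disjoint_edgeCells {e e' : E} (h : e ≠ e') : Disjoint (edgeCells V e) (edgeCells V e') := by
  refine Set.disjoint_left.2 fun i (h1 : i.1 = _) (h2 : i.1 = _) => h ?_
  simpa using h1.symm.trans h2

/-- A label determines its vertex, an edge label through the source; intersections of vertex sets
are respected for this reason. -/
theorem eq_of_mem_vertCells {x y : V} {i : CellLabel V E} (hx : i ∈ G.vertCells x)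
    (hy : i ∈ G.vertCells y) : x = y := by
  rcases hx with ⟨e, h1, h2⟩ | ⟨h1, -⟩ <;> rcases hy with ⟨e', h3, h4⟩ | ⟨h3, -⟩ <;> grind

theorem genCells_empty : G.genCells ∅ = ∅ := by simp [genCells]

theorem genCells_singleton (x : V) : G.genCells {x} = G.vertCells x := by
  ext i; simp [genCells]

theorem genCells_inter (A B : Set V) : G.genCells A ∩ G.genCells B = G.genCells (A ∩ B) := by
  ext i
  constructor
  · rintro ⟨⟨x, hx, h1⟩, y, hy, h2⟩
    exact ⟨x, ⟨hx, eq_of_mem_vertCells h1 h2 ▸ hy⟩, h1⟩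
  · rintro ⟨x, ⟨hx, hy⟩, h⟩
    exact ⟨⟨x, hx, h⟩, x, hy, h⟩

theorem genCells_union (A B : Set V) : G.genCells A ∪ G.genCells B = G.genCells (A ∪ B) := by
  ext i
  simp only [genCells, Set.mem_union, Set.mem_ofPred_eq, or_and_right, exists_or]

theorem edgeCells_subset_genCells (e : E) : edgeCells V e ⊆ G.genCells {G.source e} := by
  rw [genCells_singleton]
  exact fun i hi => Or.inl ⟨e, rfl, hi⟩

theorem genCells_singleton_of_regular {x : V} (hx : (G.emitted x).Finite)
    (hne : (G.emitted x).Nonempty) : G.genCells {x} = ⋃ e ∈ G.emitted x, edgeCells V e := by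
  ext i
  simp [genCells_singleton, vertCells, edgeCells, emitted]
  tauto

theorem infinite_setOf_fst_eq {α : Type*} (a : α) : {i : α × ℕ | i.1 = a}.Infinite :=
  Set.infinite_of_injective_forall_mem (f := fun m : ℕ => (a, m))
    (fun _ _ h => congrArg Prod.snd h) fun _ => rfl

theorem infinite_genCells {A : Set V} (hA : A.Nonempty) : (G.genCells A).Infinite := by
  obtain ⟨x, hx⟩ := hA
  by_cases h : (G.emitted x).Finite ∧ (G.emitted x).Nonempty
  · obtain ⟨e, he⟩ := h.2
    exact (infinite_setOf_fst_eq _).mono fun i hi => ⟨x, hx, Or.inl ⟨e, he, hi⟩⟩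
  · exact (infinite_setOf_fst_eq _).mono fun i hi => ⟨x, hx, Or.inr ⟨hi, h⟩⟩

/-- The labels over `none` belong to no vertex. They leave room to extend a bijection between two
label sets to a permutation of all labels. -/
theorem infinite_compl_genCells (A : Set V) : (G.genCells A)ᶜ.Infinite := by
  refine (infinite_setOf_fst_eq (none : Option (V ⊕ E))).mono fun i (hi : i.1 = none) h => ?_
  obtain ⟨x, -, ⟨e, -, h⟩ | ⟨h, -⟩⟩ := h <;> simp [hi] at h

theorem infinite_compl_edgeCells (e : E) : (edgeCells V e)ᶜ.Infinite := by
  refine (infinite_setOf_fst_eq (none : Option (V ⊕ E))).mono fun i (hi : i.1 = none) h => ?_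
  simp [edgeCells, hi] at h

/-- In a countable type, any two infinite sets with infinite complements are exchanged by a
permutation. -/
theorem exists_perm_preimage_eq {α : Type*} [Countable α] {S T : Set α} (hS : S.Infinite)
    (hT : T.Infinite) (hS' : Sᶜ.Infinite) (hT' : Tᶜ.Infinite) :
    ∃ σ : Equiv.Perm α, σ ⁻¹' T = S := by
  classical
  have key : ∀ {p q : α → Prop}, {a | p a}.Infinite → {a | q a}.Infinite →
      Nonempty ({a // p a} ≃ {a // q a}) := fun {p q} hp hq => by
    have : Infinite {a // p a} := hp.to_subtype
    have : Infinite {a // q a} := hq.to_subtype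
    exact nonempty_equiv_of_countable
  obtain ⟨φ⟩ := key (p := (· ∈ S)) (q := (· ∈ T)) hS hT
  obtain ⟨ψ⟩ := key (p := (· ∉ S)) (q := (· ∉ T)) hS' hT'
  refine ⟨Equiv.subtypeCongr φ ψ, Set.ext fun a => ?_⟩
  by_cases h : a ∈ S
  · simp [h, Equiv.subtypeCongr, Equiv.sumCompl_symm_apply_of_pos (p := (· ∈ S)) h]
  · simpa [h, Equiv.subtypeCongr, Equiv.sumCompl_symm_apply_of_neg (p := (· ∈ S)) h] using
      (ψ ⟨a, h⟩).2

/-! ### The permutation attached to an edge. -/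

variable (G)

/-- The first clause alone would allow a nontrivial shuffle around a cycle. The second keeps the
`ℕ`-coordinate along exitless edges, so the composite around the cycle is the identity on its
labels. -/
theorem exists_edgePerm (e : E) : ∃ σ : Equiv.Perm (CellLabel V E),
    σ ⁻¹' G.genCells (G.range e) = edgeCells V e ∧
      ∀ e', G.genCells (G.range e) = edgeCells V e' →
        ∀ m, σ (some (.inr e), m) = (some (.inr e'), m) := by
  classical
  by_cases h : ∃ e', G.genCells (G.range e) = edgeCells V e'
  · obtain ⟨e', he'⟩ := h
    refine ⟨(Equiv.swap (some (.inr e)) (some (.inr e'))).prodCongr (Equiv.refl ℕ), ?_, ?_⟩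
    · ext i
      rw [he']
      simp [edgeCells, Equiv.swap_apply_eq_iff]
    · intro e'' h m
      -- Label sets of distinct edges are disjoint and nonempty, so the successor edge is unique.
      have : e' = e'' := by
        by_contra hne
        exact Set.disjoint_left.1 (disjoint_edgeCells hne) (mk_mem_edgeCells e' 0)
          (h ▸ he' ▸ mk_mem_edgeCells e' 0)
      simp [this]
  · have := G.countable_vertices
    have := G.countable_edges
    obtain ⟨σ, hσ⟩ := exists_perm_preimage_eq (infinite_setOf_fst_eq _)
      (infinite_genCells (G.range_nonempty e)) (infinite_compl_edgeCells e)
      (infinite_compl_genCells (G.range e))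
    exact ⟨σ, hσ, fun e' he' => (h ⟨e', he'⟩).elim⟩

/-- A permutation of the labels that takes those of `e` to those of `r(e)`. -/
noncomputable def edgePerm (e : E) : Equiv.Perm (CellLabel V E) := (G.exists_edgePerm e).choose

theorem edgePerm_preimage (e : E) : G.edgePerm e ⁻¹' G.genCells (G.range e) = edgeCells V e :=
  (G.exists_edgePerm e).choose_spec.1

theorem edgePerm_inv_preimage (e : E) :
    ⇑(G.edgePerm e)⁻¹ ⁻¹' edgeCells V e = G.genCells (G.range e) := by
  rw [← G.edgePerm_preimage]
  ext i
  simp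

variable {G} in
theorem edgePerm_apply {e e' : E} (h : G.genCells (G.range e) = edgeCells V e') (m : ℕ) :
    G.edgePerm e (some (.inr e), m) = (some (.inr e'), m) :=
  (G.exists_edgePerm e).choose_spec.2 e' h m

/-! ### The branching system and its phase-twisted Cuntz–Krieger families. -/

open UnitCells

theorem map_edgePerm_inv_restrict (c : CellLabel V E ≃ ℤ) (e : E) :
    Measure.map (permute c (G.edgePerm e)⁻¹)
      (volume.restrict (label c ⁻¹' G.genCells (G.range e))) =
        volume.restrict (label c ⁻¹' edgeCells V e) := by
  rw [← edgePerm_inv_preimage, map_permute_restrict]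

/-- The branching system on the line in which every set is a union of unit intervals and every map
is a piecewise translation that permutes the unit intervals. -/
noncomputable def cellSystem (c : CellLabel V E ≃ ℤ) :
    G.BranchingSystem (volume : Measure ℝ) where
  R e := label c ⁻¹' edgeCells V e
  D A := label c ⁻¹' G.genCells A.1
  f e := permute c (G.edgePerm e)⁻¹
  g e := permute c (G.edgePerm e)
  measurableSet_R _ := measurableSet_label c _
  measurableSet_D _ := measurableSet_label c _
  R_disjoint e e' h := by
    rw [← Set.preimage_inter, (disjoint_edgeCells h).inter_eq, Set.preimage_empty]
    rfl
  D_empty := by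
    change label c ⁻¹' G.genCells ∅ = ∅
    rw [genCells_empty, Set.preimage_empty]
  D_inter A B := by
    rw [← Set.preimage_inter, genCells_inter]
    rfl
  D_union A B := by
    rw [← Set.preimage_union, genCells_union]
    rfl
  R_subset e := (Set.preimage_mono (edgeCells_subset_genCells e)).eventuallyLE
  D_vert x hx hne := by
    change label c ⁻¹' G.genCells {x} =ᵐ[volume] _
    rw [genCells_singleton_of_regular hx hne, Set.preimage_iUnion₂]
    rfl
  measurable_f _ := measurable_permute c _
  measurable_g _ := measurable_permute c _
  mapsTo_f e x hx := by
    rw [Set.mem_preimage, label_permute, ← Set.mem_preimage, edgePerm_inv_preimage]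
    exact hx
  mapsTo_g e x hx := by
    rw [Set.mem_preimage, label_permute]
    change label c x ∈ G.edgePerm e ⁻¹' G.genCells (G.range e)
    rwa [edgePerm_preimage]
  f_g e := .of_forall fun x => permute_inv_permute c _ x
  g_f e := .of_forall fun x => permute_permute_inv c _ x
  map_g_ac e := by
    rw [← edgePerm_preimage]
    exact (map_permute_restrict c _ _).le.absolutelyContinuous
  map_f_ac e := (G.map_edgePerm_inv_restrict c e).le.absolutelyContinuous

/-- The operators of `cellSystem` with a phase `ζ` on the partial isometries. -/
noncomputable def cellFamily (c : CellLabel V E ≃ ℤ) (ζ : ℂ) (hζ : star ζ * ζ = 1) :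
    G.CKFamily (Lp ℂ 2 (volume : Measure ℝ) →L[ℂ] Lp ℂ 2 (volume : Measure ℝ)) :=
  -- The phase cancels in `s_e s_e^*`, and likewise in `s_e^* s_e`, so the relations hold for every
  -- `ζ` of modulus 1.
  have hss : ∀ e, (ζ • (proj c (edgeCells V e) * unit c (G.edgePerm e))) *
      star (ζ • (proj c (edgeCells V e) * unit c (G.edgePerm e))) = proj c (edgeCells V e) :=
    fun e => by
      rw [star_smul, smul_mul_smul_comm, mul_comm ζ, hζ, one_smul, star_mul, star_proj, star_unit,
        mul_assoc, ← mul_assoc (unit c _), unit_mul_unit, inv_mul_cancel, unit_one, one_mul,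
        proj_mul_proj, Set.inter_self]
  { s := fun e => ζ • (proj c (edgeCells V e) * unit c (G.edgePerm e))
    p := fun A => proj c (G.genCells A.1)
    isPartialIsometry := fun e => by
      rw [hss, mul_smul_comm, ← mul_assoc, proj_mul_proj, Set.inter_self]
    orthogonal_ranges := fun e e' h => by
      rw [hss, hss, proj_mul_proj, (disjoint_edgeCells h).inter_eq, proj_empty]
    isProjection := fun A => isStarProjection_proj c _
    p_empty := by
      change proj c (G.genCells ∅) = 0
      rw [genCells_empty, proj_empty]
    p_inter := fun A B => by
      rw [proj_mul_proj, genCells_inter]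
      rfl
    p_union := fun A B => by
      change proj c (G.genCells (A.1 ∪ B.1)) = _ + _ - proj c (G.genCells (A.1 ∩ B.1))
      rw [← genCells_union, ← genCells_inter, proj_union]
    star_s_mul_s := fun e => by
      rw [star_smul, smul_mul_smul_comm, hζ, one_smul, star_mul, star_proj, star_unit,
        mul_assoc, ← mul_assoc (proj c _), proj_mul_proj, Set.inter_self, ← mul_assoc,
        unit_mul_proj, mul_assoc, unit_mul_unit, mul_inv_cancel, unit_one, mul_one,
        edgePerm_inv_preimage]
      rfl
    range_le := fun e => by
      rw [hss, proj_mul_proj]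
      congr 1
      exact Set.inter_eq_self_of_subset_right (edgeCells_subset_genCells e)
    sum_eq := fun x hx hne => by
      simp_rw [hss]
      rw [← proj_biUnion c _ _ fun e e' h => disjoint_edgeCells h]
      change proj c (G.genCells {x}) = _
      rw [genCells_singleton_of_regular hx hne]
      simp }

theorem isInducedRep_cellFamily (c : CellLabel V E ≃ ℤ) :
    (G.cellSystem c).IsInducedRep (G.algEval ⟨_, G.cellFamily c 1 (by simp)⟩) := by
  refine ⟨fun e φ => ?_, fun A φ => coeFn_proj c _ φ⟩
  have hd : ∀ᵐ x, x ∈ label c ⁻¹' edgeCells V e → (G.cellSystem c).derivInv e x = 1 := by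
    rw [← ae_restrict_iff' (measurableSet_label c _)]
    change (Measure.map (permute c (G.edgePerm e)⁻¹)
      (volume.restrict (label c ⁻¹' G.genCells (G.range e)))).rnDeriv
      (volume.restrict (label c ⁻¹' edgeCells V e)) =ᵐ[_] fun _ => 1
    rw [map_edgePerm_inv_restrict]
    exact Measure.rnDeriv_self _
  have h1 : G.algEval ⟨_, G.cellFamily c 1 (by simp)⟩ (G.algS e) =
      proj c (edgeCells V e) * unit c (G.edgePerm e) := one_smul ℂ _
  rw [h1]
  filter_upwards [coeFn_proj_mul_unit c (edgeCells V e) (G.edgePerm e) φ, hd] with x h2 h3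
  rw [h2]
  change _ = (label c ⁻¹' edgeCells V e).indicator _ x
  by_cases hx : x ∈ label c ⁻¹' edgeCells V e
  · rw [Set.indicator_of_mem hx, Set.indicator_of_mem hx, h3 hx]
    simp [cellSystem]
  · rw [Set.indicator_of_notMem hx, Set.indicator_of_notMem hx]

/-! ### Cycles without exits -/

variable {G}

/-- Without exits, each vertex of `r(α_i)` emits an edge, which can only be `α_{i+1}`; hence the
vertex is `s(α_{i+1})`. It is regular and has no labels beyond those of `α_{i+1}`. Reading the
indices modulo `n + 1` turns the cycle into a sequence on `ℕ`, so that words can be handled by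
induction. -/
theorem exists_periodic_of_not_conditionL (hL : ¬ G.ConditionL) :
    ∃ (N : ℕ) (β : ℕ → E), β (N + 1) = β 0 ∧
      (∀ k, G.range (β k) = {G.source (β (k + 1))}) ∧
      ∀ k, G.genCells (G.range (β k)) = edgeCells V (β (k + 1)) := by
  simp only [ConditionL, HasExits, not_forall, not_or, not_exists, not_and, ne_eq, not_not] at hL
  obtain ⟨n, α, -, h1, h2⟩ := hL
  refine ⟨n, fun k => α (Fin.ofNat (n + 1) k), by simp, forall_and.1 fun k => ?_⟩
  have hk : Fin.ofNat (n + 1) (k + 1) = Fin.ofNat (n + 1) k + 1 := by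
    ext
    simp [Fin.val_add]
  simp only [hk]
  generalize Fin.ofNat (n + 1) k = i
  have h3 : ∀ x ∈ G.range (α i), G.emitted x = {α (i + 1)} := fun x hx =>
    (Set.Nonempty.subset_singleton_iff (Set.nonempty_iff_ne_empty.2 (h2 i x hx))).1
      fun e (he : G.source e = x) => h1 i ▸ (show G.source e ∈ _ from he ▸ hx)
  have h4 : G.range (α i) = {G.source (α (i + 1))} := by
    refine (Set.Nonempty.subset_singleton_iff (G.range_nonempty _)).1 fun x hx => ?_
    have : α (i + 1) ∈ G.emitted x := h3 x hx ▸ rfl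
    exact this.symm
  have h5 := h3 (G.source (α (i + 1))) (h4 ▸ rfl)
  refine ⟨h4, ?_⟩
  rw [h4, genCells_singleton_of_regular (by simp [h5]) (by simp [h5]), h5, Set.biUnion_singleton]

/-- The product `p_{s(β_0)} s_{β_0} ⋯ s_{β_{k-1}}` in `C*(𝒢)`. -/
noncomputable def algWord (G : Ultragraph V E) (β : ℕ → E) : ℕ → G.Alg
  | 0 => G.algP (G.vert (G.source (β 0)))
  | k + 1 => algWord G β k * G.algS (β k)

/-- The composition of the label permutations along `β`. -/
noncomputable def wordPerm (G : Ultragraph V E) (β : ℕ → E) : ℕ → Equiv.Perm (CellLabel V E)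
  | 0 => 1
  | k + 1 => G.edgePerm (β k) * wordPerm G β k

theorem wordPerm_apply {β : ℕ → E}
    (hβ : ∀ k, G.genCells (G.range (β k)) = edgeCells V (β (k + 1))) (k m : ℕ) :
    G.wordPerm β k (some (.inr (β 0)), m) = (some (.inr (β k)), m) := by
  induction k with
  | zero => rfl
  | succ k ih => rw [wordPerm, Equiv.Perm.mul_apply, ih, edgePerm_apply (hβ k)]

theorem algEval_algWord (c : CellLabel V E ≃ ℤ) (ζ : ℂ) (hζ : star ζ * ζ = 1) {β : ℕ → E}
    (h0 : G.genCells {G.source (β 0)} = edgeCells V (β 0))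
    (hβ : ∀ k, G.genCells (G.range (β k)) = edgeCells V (β (k + 1))) (k : ℕ) :
    G.algEval ⟨_, G.cellFamily c ζ hζ⟩ (G.algWord β k) =
      ζ ^ k • (proj c (edgeCells V (β 0)) * unit c (G.wordPerm β k)) := by
  induction k with
  | zero =>
    rw [pow_zero, one_smul, wordPerm, unit_one, mul_one, ← h0]
    rfl
  | succ k ih =>
    have hs : G.algEval ⟨_, G.cellFamily c ζ hζ⟩ (G.algS (β k)) =
      ζ • (proj c (edgeCells V (β k)) * unit c (G.edgePerm (β k))) := rfl
    rw [algWord, map_mul, ih, hs, wordPerm, ← unit_mul_unit, pow_succ]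
    -- The permutation of the first `k` edges moves the labels of `β 0` to those of `β k`, so the
    -- intermediate projection is absorbed by the leftmost one.
    have hsub : edgeCells V (β 0) ⊆ G.wordPerm β k ⁻¹' edgeCells V (β k) := by
      rintro ⟨a, m⟩ (rfl : a = _)
      rw [Set.mem_preimage, wordPerm_apply hβ]
      exact mk_mem_edgeCells _ _
    have := smul_mul_smul_comm (ζ ^ k) (proj c (edgeCells V (β 0)) * unit c (G.wordPerm β k)) ζ
      (proj c (edgeCells V (β k)) * unit c (G.edgePerm (β k)))
    refine this.trans ?_
    rw [mul_assoc, ← mul_assoc (unit c _), unit_mul_proj, mul_assoc (proj c _), ← mul_assoc,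
      proj_mul_proj, Set.inter_eq_self_of_subset_left hsub]

theorem algEval_algWord_of_periodic (c : CellLabel V E ≃ ℤ) (ζ : ℂ) (hζ : star ζ * ζ = 1)
    {β : ℕ → E} {N : ℕ} (hN : β N = β 0)
    (h0 : G.genCells {G.source (β 0)} = edgeCells V (β 0))
    (hβ : ∀ k, G.genCells (G.range (β k)) = edgeCells V (β (k + 1))) :
    G.algEval ⟨_, G.cellFamily c ζ hζ⟩ (G.algWord β N) = ζ ^ N • proj c (edgeCells V (β 0)) := by
  rw [algEval_algWord c ζ hζ h0 hβ, proj_mul_unit_of_fixed]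
  rintro ⟨a, m⟩ (rfl : a = _)
  rw [wordPerm_apply hβ, hN]

end Ultragraph

theorem mainTheorem3 {V : Type*} {E : Type*} (G : Ultragraph V E) (hL : ¬ G.ConditionL) :
    ∃ (S : G.BranchingSystem (volume : Measure ℝ))
      (π : G.Alg →⋆ₙₐ[ℂ] (Lp ℂ 2 (volume : Measure ℝ) →L[ℂ] Lp ℂ 2 (volume : Measure ℝ))),
      S.IsInducedRep π ∧
      (∀ A : G.GenVertex, A.carrier.Nonempty → π (G.algP A) ≠ 0) ∧
      ¬ Function.Injective π := by
  open Ultragraph UnitCells in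
  have := G.countable_vertices
  have := G.countable_edges
  obtain ⟨c⟩ : Nonempty (CellLabel V E ≃ ℤ) := nonempty_equiv_of_countable
  refine ⟨G.cellSystem c, G.algEval ⟨_, G.cellFamily c 1 (by simp)⟩, G.isInducedRep_cellFamily c,
    fun A hA => proj_ne_zero c (infinite_genCells hA).nonempty, fun hinj => ?_⟩
  obtain ⟨N, β, hN, hr, hβ⟩ := exists_periodic_of_not_conditionL hL
  -- The edge `β 0 = β (N + 1)` is the successor of `β N`, whose range is `{s(β 0)}`.
  have h0 : G.genCells {G.source (β 0)} = edgeCells V (β 0) := by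
    rw [← hN, ← hr, hβ]
  -- The cycle has length `N + 1`; any `ζ` of modulus 1 with `ζ ^ (N + 1) ≠ 1` would separate the
  -- word from the projection.
  obtain ⟨ζ, hζ, hpow⟩ : ∃ ζ : ℂ, star ζ * ζ = 1 ∧ ζ ^ (N + 1) = -1 := by
    refine ⟨Complex.exp ((Real.pi / (N + 1) : ℝ) * Complex.I), ?_, ?_⟩
    · change (starRingEnd ℂ) _ * _ = 1
      rw [← Complex.normSq_eq_conj_mul_self, Complex.normSq_eq_norm_sq,
        Complex.norm_exp_ofReal_mul_I]
      simp
    · rw [← Complex.exp_nat_mul, ← Complex.exp_pi_mul_I]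
      have : (N : ℂ) + 1 ≠ 0 := Nat.cast_add_one_ne_zero N
      congr 1
      push_cast
      field_simp
  have h1 := algEval_algWord_of_periodic c 1 (by simp) hN h0 hβ
  rw [one_pow, one_smul] at h1
  have hp : ∀ ζ hζ, G.algEval ⟨_, G.cellFamily c ζ hζ⟩ (G.algP (G.vert (G.source (β 0)))) =
      proj c (edgeCells V (β 0)) := fun ζ hζ => congrArg (proj c) h0
  -- Injectivity would make the cycle word equal to the vertex projection in `C*(𝒢)` itself, hence
  -- in every Cuntz–Krieger family; the twisted one then gives `P = -P` for a nonzero projection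
  -- `P`.
  have h2 := hinj (h1.trans (hp _ _).symm)
  have h3 := algEval_algWord_of_periodic c ζ hζ hN h0 hβ
  rw [h2, hp, hpow, neg_one_smul] at h3
  refine proj_ne_zero c ⟨_, mk_mem_edgeCells (β 0) 0⟩ ((smul_eq_zero_iff_right (two_ne_zero (α := ℂ))).1 ?_)
  exact (two_smul ℂ _).trans (eq_neg_iff_add_eq_zero.1 h3)
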